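/- Let $\mathbb{K}$ be $\mathbb{R}$ or $\mathbb{C}$ and let $X$, $Y$ be Banach spaces over $\mathbb{K}$, with closed unit balls $B_X$, $B_Y$. Write $\mathcal{L}(X,Z)$ for the space of bounded linear operators from $X$ to a Banach space $Z$, with the operator norm, $X^*=\mathcal{L}(X,\mathbb{K})$, and $\mathbb{T}=\{\theta\in\mathbb{K}:|\theta|=1\}$. For a Banach space $E$ over $\mathbb{K}$ and $C\subseteq E$, a functional $x^*\in E^*$ strongly exposes $x_0\in C$ in $C$ if $\operatorname{Re}x^*(x_0)=\sup_{C}\operatorname{Re}x^*$ and every sequence $(x_n)$ in $C$ with $\operatorname{Re}x^*(x_n)\to\operatorname{Re}x^*(x_0)$ converges to $x_0$ in norm; then $x_0$ is a strongly exposed point of $C$. $\operatorname{SE}(X)\subseteq X^*$ is the set of functionals that strongly expose some point in $B_X$. $\operatorname{NA}(X,Z)$ is the set of $T\in\mathcal{L}(X,Z)$ with $\|Tx\|=\|T\|$ for some $x\in X$ with $\|x\|=1$. $\operatorname{ASE}(X,Z)$ is the set of $T\in\mathcal{L}(X,Z)$ for which there is $x_0\in B_X$ such that for every sequence $(x_n)$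 in $B_X$ with $\|Tx_n\|\to\|T\|$ there are $\theta_n\in\mathbb{T}$ with $\theta_nx_n\to x_0$. A set $A$ is discrete up to rotations if, whenever a sequence $(a_n)$ in $A$ converges in norm to some $a\in A$, for all sufficiently large $n$ there is $\theta_n\in\mathbb{T}$ with $a_n=\theta_na$. A Banach space has the Radon-Nikodym property (RNP) if every nonempty bounded subset of it is dentable, that is, has nonempty slices (intersections with open half-spaces) of arbitrarily small diameter. A subset of a complete metric space is residual if it contains a dense $G_\delta$ set. **Theorem.** Suppose that $Y$ has the RNP and that the set of strongly exposed points of $B_Y$ is discrete up to rotations. Let $\mathcal{I}(X,Y^*)$ be a closed linear subspace of $\mathcal{L}(X,Y^*)$ containing all rank-one operators $x\mapsto x^*(x)\,y^*$ ($x^*\in X^*$, $y^*\in Y^*$). (a) If $\operatorname{NA}(X,\mathbb{K})$ is residual in $X^*$, then $\operatorname{NA}(X,Y^*)\cap\mathcal{I}(X,Y^*)$ is residual in $\mathcal{I}(X,Y^*)$. (b) If $\operatorname{SE}(X)$ is dense in $X^*$, then the elements of $\mathcal{I}(X,Y^*)$ at which the norm of $\mathcal{L}(X,Y^*)$ is Fréchet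 differentiable are dense in $\mathcal{I}(X,Y^*)$. In particular, if $Y\neq\{0\}$, then $\operatorname{ASE}(X,Y^*)\cap\mathcal{I}(X,Y^*)$ is dense in $\mathcal{I}(X,Y^*)$. -/

import Mathlib

open Filter Topology

section NormAttaining

variable (𝕜 : Type*) [RCLike 𝕜]
variable {E F : Type*} [NormedAddCommGroup E] [NormedSpace 𝕜 E]
  [NormedAddCommGroup F] [NormedSpace 𝕜 F]

/-- A set `C` is dentable if it has nonempty slices, that is, nonempty intersections
`{x ∈ C | α < Re f x}` with open half-spaces, of arbitrarily small diameter. -/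
def IsDentable (C : Set E) : Prop :=
  ∀ ε : ℝ, 0 < ε → ∃ (f : StrongDual 𝕜 E) (α : ℝ),
    (∃ x ∈ C, α < RCLike.re (f x)) ∧
    ∀ x ∈ C, ∀ y ∈ C, α < RCLike.re (f x) → α < RCLike.re (f y) → dist x y < ε

variable (E) in
/-- The Radon-Nikodym property (RNP) of a Banach space, in its geometric form: every nonempty
bounded subset is dentable. -/
def HasRNP : Prop :=
  ∀ C : Set E, C.Nonempty → Bornology.IsBounded C → IsDentable 𝕜 C

/-- A subset `A` is discrete up to rotations if every sequence in `A` converging in norm to some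
`a ∈ A` eventually consists of rotations of `a`. -/
def IsDiscreteUpToRotations (A : Set E) : Prop :=
  ∀ (u : ℕ → E) (a : E), (∀ n, u n ∈ A) → a ∈ A → Tendsto u atTop (𝓝 a) →
    ∀ᶠ n in atTop, ∃ θ : 𝕜, ‖θ‖ = 1 ∧ u n = θ • a

variable {𝕜}

/-- The functional `f` strongly exposes `x₀` in `C`: `Re f` attains its supremum over `C` at
`x₀ ∈ C`, and every sequence in `C` along which `Re f` tends to that supremum converges to
`x₀` in norm. -/
def StronglyExposes (f : StrongDual 𝕜 E) (C : Set E) (x₀ : E) : Prop :=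
  x₀ ∈ C ∧ (∀ x ∈ C, RCLike.re (f x) ≤ RCLike.re (f x₀)) ∧
    ∀ u : ℕ → E, (∀ n, u n ∈ C) →
      Tendsto (fun n => RCLike.re (f (u n))) atTop (𝓝 (RCLike.re (f x₀))) →
      Tendsto u atTop (𝓝 x₀)

variable (𝕜)

/-- The set of strongly exposed points of `C`. -/
def strongExp (C : Set E) : Set E :=
  {x₀ | ∃ f : StrongDual 𝕜 E, StronglyExposes f C x₀}

variable (E) in
/-- The set of functionals that strongly expose the closed unit ball of `E` at some point. -/
def SE : Set (StrongDual 𝕜 E) :=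
  {f | ∃ x₀ : E, StronglyExposes f (Metric.closedBall (0 : E) 1) x₀}

variable (E F)

/-- The set of norm attaining operators: `‖T‖ = ‖T x‖` for some norm-one `x`. -/
def NA : Set (E →L[𝕜] F) :=
  {T | ∃ x : E, ‖x‖ = 1 ∧ ‖T x‖ = ‖T‖}

/-- The set of absolutely strongly exposing operators: there is `x₀` in the closed unit ball such
that every sequence in the ball with `‖T xₙ‖ → ‖T‖ = sup {‖T x‖ : ‖x‖ ≤ 1}` converges to `x₀`
after multiplication by suitable scalars of modulus one. -/
def ASE : Set (E →L[𝕜] F) :=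
  {T | ∃ x₀ ∈ Metric.closedBall (0 : E) 1,
    ∀ u : ℕ → E, (∀ n, u n ∈ Metric.closedBall (0 : E) 1) →
      Tendsto (fun n => ‖T (u n)‖) atTop (𝓝 ‖T‖) →
      ∃ θ : ℕ → 𝕜, (∀ n, ‖θ n‖ = 1) ∧ Tendsto (fun n => θ n • u n) atTop (𝓝 x₀)}

variable {E}

/-- The norm of `E` is Frechet differentiable at `v` (as a real-valued function on the real normed
space underlying `E`). -/
def NormFrechetDifferentiableAt (v : E) : Prop :=
  letI : NormedSpace ℝ E := NormedSpace.restrictScalars ℝ 𝕜 E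
  DifferentiableAt ℝ (fun w : E => ‖w‖) v

end NormAttaining

/-!
Let `T : X →L[𝕜] StrongDual 𝕜 Y` with transpose `T.flip : Y →L[𝕜] StrongDual 𝕜 X`. Suppose that
`T.flip` absolutely strongly exposes the unit ball of `Y` at `y₀` (`AbsExposesAt`). Then `‖T‖` is
the norm of the functional `T.flip y₀` on `X`, so `T` attains its norm as soon as `T.flip y₀` does;
and if `T.flip y₀` absolutely strongly exposes the ball of `X` at `x₀`, then `T` does so too
(`AbsExposesAt.of_flip`), and Šmulian's criterion, for the functionals `S ↦ S x y`, makes the norm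
Fréchet differentiable at `T` with derivative `S ↦ Re S x₀ y₀` once `x₀` is rotated so that
`T x₀ y₀ = ‖T‖` (`AbsExposesAt.normFrechetDifferentiableAt`).

Both parts therefore follow from `exists_absExposesAt_flip_apply_mem_residual`: given a residual set
`R` of functionals on `X`, generic operators in `I` have a transpose that exposes at some `y₀` with
`T.flip y₀ ∈ R`. Part (a) takes for `R` the norm-attaining functionals, and part (b) those that
absolutely strongly expose the ball of `X`; the latter form a residual set as soon as the strongly
exposing functionals are dense. Two facts about `Y` enter.

* By the Radon-Nikodym property, transposes of generic operators in `I` expose the ball of `Y`. The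
  functions `y ↦ ‖T.flip y‖` acquire small slices under small linear perturbations, by an
  approximate form of Stegall's variational principle (`exists_small_slice_add`), and such a
  perturbation is realized by adding a rank-one operator to `T`
  (`exists_smulRight_add_flip_mem_nearlyExposing`).
* The point at which `T.flip` exposes varies continuously with `T` up to rotation and is a strongly
  exposed point of the ball, so by discreteness it is locally constant up to rotation
  (`AbsExposesAt.exists_radius`). Locally, `T ↦ T.flip y₀` is then a fixed open map onto the dual of
  `X`, and it pulls residual sets back to residual sets.
-/

/-! ### Ekeland's principle and subgradients -/

/-- **Ekeland's variational principle** for a continuous function bounded below on a complete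
metric space. -/
theorem exists_ekeland_point {E : Type*} [MetricSpace E] [CompleteSpace E] {F : E → ℝ}
    (hF : Continuous F) (hb : BddBelow (Set.range F)) {c : ℝ} (hc : 0 < c) (y : E) :
    ∃ z, F z + c * dist y z ≤ F y ∧ ∀ w, F z ≤ F w + c * dist w z := by
  let S : E → Set E := fun x => {w | F w + c * dist x w ≤ F x}
  have hself : ∀ x, x ∈ S x := fun x => by simp [S]
  have htrans : ∀ {x w v}, w ∈ S x → v ∈ S w → v ∈ S x := by
    intro x w v hw hv
    simp only [S, Set.mem_ofPred_eq] at *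
    nlinarith [mul_le_mul_of_nonneg_left (dist_triangle x w v) hc.le]
  have hSb : ∀ x, BddBelow (F '' S x) := fun x => hb.mono (Set.image_subset_range _ _)
  have hSc : ∀ x, IsClosed (S x) := fun x =>
    isClosed_le (hF.add (continuous_const.mul (continuous_const.dist continuous_id)))
      continuous_const
  have hstep : ∀ (n : ℕ) (x : E), ∃ w ∈ S x, ∀ v ∈ S x, F w ≤ F v + (1 / 2 : ℝ) ^ n := by
    intro n x
    obtain ⟨_, ⟨w, hw, rfl⟩, hlt⟩ := Real.lt_sInf_add_pos
      (s := F '' S x) ⟨_, x, hself x, rfl⟩ (show (0 : ℝ) < (1 / 2 : ℝ) ^ n by positivity)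
    exact ⟨w, hw, fun v hv => by
      have := csInf_le (hSb x) ⟨v, hv, rfl⟩
      linarith⟩
  choose next hnext hmin using hstep
  let x : ℕ → E := fun n => Nat.rec y (fun k z => next k z) n
  have hx : ∀ n, x (n + 1) = next n (x n) := fun n => rfl
  have hmem : ∀ n m, n ≤ m → x m ∈ S (x n) := by
    intro n m hnm
    induction m, hnm using Nat.le_induction with
    | base => exact hself _
    | succ m _ ih => exact htrans ih (hx m ▸ hnext m (x m))
  have hsmall : ∀ n, ∀ w ∈ S (x (n + 1)), dist (x (n + 1)) w ≤ (1 / 2 : ℝ) ^ n / c := by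
    intro n w hw
    have h1 : w ∈ S (x n) := htrans (hmem n (n + 1) n.le_succ) hw
    have h2 := hmin n (x n) w h1
    rw [← hx] at h2
    simp only [S, Set.mem_ofPred_eq] at hw
    rw [le_div_iff₀ hc]
    linarith
  have hlim : Tendsto (fun n : ℕ => (1 / 2 : ℝ) ^ n / c) atTop (𝓝 0) := by
    simpa using (tendsto_pow_atTop_nhds_zero_of_lt_one (by norm_num : (0 : ℝ) ≤ 1 / 2)
      (by norm_num)).div_const c
  have hcau : CauchySeq fun n => x (n + 1) :=
    cauchySeq_of_le_tendsto_0' _ (fun n m hnm => hsmall n _ (hmem (n + 1) (m + 1) (by omega))) hlim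
  obtain ⟨z, hz⟩ := cauchySeq_tendsto_of_complete hcau
  have hzS : ∀ n, z ∈ S (x n) := fun n =>
    (hSc (x n)).mem_of_tendsto hz ((eventually_ge_atTop n).mono fun m hm =>
      hmem n (m + 1) (by omega))
  refine ⟨z, hzS 0, fun w => ?_⟩
  by_contra! hw
  have hwS : w ∈ S z := by
    simp only [S, Set.mem_ofPred_eq]
    rw [dist_comm]
    exact hw.le
  have hzw : Tendsto (fun n => x (n + 1)) atTop (𝓝 w) := by
    rw [tendsto_iff_dist_tendsto_zero]
    exact squeeze_zero (fun _ => dist_nonneg)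
      (fun n => hsmall n w (htrans (hzS (n + 1)) hwS)) hlim
  rw [tendsto_nhds_unique hz hzw] at hw
  simp at hw

/-- A minimizer `z` of `h + c ‖· - z‖`, for `h` convex and continuous, is a point at which `h` has
a subgradient of norm at most `c`: the open strict epigraph of `h` is separated from the
hypograph of `h z - c ‖· - z‖`. -/
theorem exists_subgradient_of_le_add {E : Type*} [NormedAddCommGroup E] [NormedSpace ℝ E]
    {h : E → ℝ} (hconv : ConvexOn ℝ Set.univ h) (hcont : Continuous h) {c : ℝ} (hc : 0 ≤ c)
    {z : E} (hz : ∀ v, h z ≤ h v + c * ‖v - z‖) :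
    ∃ u : StrongDual ℝ E, ‖u‖ ≤ c ∧ ∀ v, h z + u (v - z) ≤ h v := by
  let s : Set (E × ℝ) := {p | p.1 ∈ Set.univ ∧ h p.1 < p.2}
  let t : Set (E × ℝ) := {p | p.2 ≤ h z - c * ‖p.1 - z‖}
  have hs : Convex ℝ s := hconv.convex_strict_epigraph
  have hso : IsOpen s := by
    have : IsOpen {p : E × ℝ | h p.1 < p.2} :=
      isOpen_lt (hcont.comp continuous_fst) continuous_snd
    simpa [s] using this
  have ht : Convex ℝ t := by
    intro p hp q hq a b ha hb hab
    simp only [t, Set.mem_ofPred_eq, Prod.fst_add, Prod.snd_add, Prod.smul_fst, Prod.smul_snd,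
      smul_eq_mul] at *
    have e : a • p.1 + b • q.1 - z = a • (p.1 - z) + b • (q.1 - z) := by
      have : z = a • z + b • z := by rw [← add_smul, hab, one_smul]
      rw [smul_sub, smul_sub]
      nth_rewrite 1 [this]
      abel
    have h1 : ‖a • p.1 + b • q.1 - z‖ ≤ a * ‖p.1 - z‖ + b * ‖q.1 - z‖ := by
      rw [e]
      refine (norm_add_le _ _).trans ?_
      rw [norm_smul, norm_smul, Real.norm_of_nonneg ha, Real.norm_of_nonneg hb]
    have h2 := mul_le_mul_of_nonneg_left h1 hc
    have h3 := mul_le_mul_of_nonneg_left hp ha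
    have h4 := mul_le_mul_of_nonneg_left hq hb
    have h5 : h z = a * h z + b * h z := by rw [← add_mul, hab, one_mul]
    nlinarith
  have hdisj : Disjoint s t := by
    rw [Set.disjoint_left]
    rintro p ⟨-, hp⟩ hq
    simp only [t, Set.mem_ofPred_eq] at hq
    linarith [hz p.1]
  obtain ⟨f, r, hfs, hft⟩ := geometric_hahn_banach_open hs hso ht hdisj
  let p : StrongDual ℝ E := f.comp (ContinuousLinearMap.inl ℝ E ℝ)
  let k : ℝ := f (0, 1)
  have hf : ∀ v a, f (v, a) = p v + a * k := by
    intro v a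
    have : (v, a) = (v, (0 : ℝ)) + a • ((0 : E), (1 : ℝ)) := by simp
    rw [this, map_add, map_smul]
    simp [p, k]
  have hs' : ∀ v a, h v < a → p v + a * k < r := fun v a ha => by
    rw [← hf]; exact hfs _ ⟨trivial, ha⟩
  have ht' : ∀ v, r ≤ p v + (h z - c * ‖v - z‖) * k := fun v => by
    rw [← hf]; exact hft _ (by simp [t])
  have hk : k < 0 := by
    have h1 := hs' z (h z + 1) (by linarith)
    have h2 := ht' z
    simp only [sub_self, norm_zero, mul_zero, sub_zero] at h2
    linarith
  have hs'' : ∀ v, p v + h v * k ≤ r := by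
    intro v
    refine le_of_forall_pos_lt_add fun e he => ?_
    have := hs' v (h v + e / (-k)) (by have := div_pos he (neg_pos.2 hk); linarith)
    have e1 : (h v + e / (-k)) * k = h v * k - e := by field_simp [hk.ne]; ring
    rw [e1] at this
    linarith
  have hrz : p z + h z * k = r := by
    refine le_antisymm (hs'' z) ?_
    simpa using ht' z
  refine ⟨(-k)⁻¹ • p, ?_, fun v => ?_⟩
  · refine ContinuousLinearMap.opNorm_le_bound _ hc fun v => ?_
    have key : ∀ v, p v ≤ (-k) * (c * ‖v‖) := by
      intro v
      have := ht' (z - v)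
      rw [← hrz, map_sub, show z - v - z = -v by abel, norm_neg] at this
      linarith
    rw [smul_apply, smul_eq_mul, Real.norm_eq_abs, abs_mul,
      abs_of_pos (inv_pos.2 (neg_pos.2 hk)), inv_mul_le_iff₀ (neg_pos.2 hk), abs_le]
    refine ⟨?_, key v⟩
    have := key (-v)
    rw [map_neg, norm_neg] at this
    linarith
  · have h1 := hs'' v
    rw [← hrz] at h1
    have h2 : p (v - z) ≤ (-k) * (h v - h z) := by rw [map_sub]; linarith
    rw [smul_apply, smul_eq_mul]
    have := (inv_mul_le_iff₀ (neg_pos.2 hk)).2 h2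
    linarith

/-! ### Small slices of perturbed functions -/

/-- The functionals `w` with `‖w‖ ≤ R` are recovered from the convex continuous function
`h y = sup {w y - g w | ‖w‖ ≤ R}`, where `g w = sup (φ + w)` over `C` is the conjugate of `-φ`.
Restricting to a ball of functionals keeps `h` finite everywhere. -/
theorem exists_convex_conjugate {E : Type*} [NormedAddCommGroup E] [NormedSpace ℝ E]
    {C : Set E} (hne : C.Nonempty) (hC : Bornology.IsBounded C) {φ : E → ℝ}
    (hφ : BddAbove (φ '' C)) {R : ℝ} (hR : 0 ≤ R) :
    ∃ (g : StrongDual ℝ E → ℝ) (h : E → ℝ), ConvexOn ℝ Set.univ h ∧ Continuous h ∧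
      (∀ w, IsLUB ((fun z => φ z + w z) '' C) (g w)) ∧
      (∀ w y, ‖w‖ ≤ R → w y - g w ≤ h y) ∧ (∀ z ∈ C, h z ≤ -φ z) ∧
      ∃ K, ∀ w, ‖w‖ ≤ R → g w ≤ K := by
  obtain ⟨z₀, hz₀⟩ := hne
  obtain ⟨M, hM⟩ := hC.exists_norm_le
  obtain ⟨K, hK⟩ := hφ
  have hM0 : 0 ≤ M := (norm_nonneg _).trans (hM z₀ hz₀)
  have hup : ∀ (w : StrongDual ℝ E), ∀ z ∈ C, φ z + w z ≤ K + ‖w‖ * M := fun w z hz =>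
    add_le_add (hK ⟨z, hz, rfl⟩) <| (le_abs_self _).trans <|
      (w.le_opNorm z).trans (mul_le_mul_of_nonneg_left (hM z hz) (norm_nonneg _))
  let g : StrongDual ℝ E → ℝ := fun w => sSup ((fun z => φ z + w z) '' C)
  have hg : ∀ w, IsLUB ((fun z => φ z + w z) '' C) (g w) := fun w =>
    isLUB_csSup ⟨_, z₀, hz₀, rfl⟩ ⟨K + ‖w‖ * M, by rintro _ ⟨z, hz, rfl⟩; exact hup w z hz⟩
  have hgle : ∀ (w : StrongDual ℝ E), ∀ z ∈ C, φ z + w z ≤ g w :=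
    fun w z hz => (hg w).1 ⟨z, hz, rfl⟩
  have hlow : ∀ (w : StrongDual ℝ E) (y : E), ‖w‖ ≤ R →
      w y - g w ≤ R * ‖y‖ + R * M - φ z₀ := by
    intro w y hw
    have h1 := hgle w z₀ hz₀
    have h2 : w y ≤ R * ‖y‖ := (le_abs_self _).trans (w.le_of_opNorm_le hw y)
    have h3 : -w z₀ ≤ R * M := (neg_le_abs _).trans <| (w.le_of_opNorm_le hw z₀).trans
      (mul_le_mul_of_nonneg_left (hM z₀ hz₀) hR)
    linarith
  let h : E → ℝ := fun y => ⨆ w : Metric.closedBall (0 : StrongDual ℝ E) R, (w.1 y - g w.1)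
  have : Nonempty (Metric.closedBall (0 : StrongDual ℝ E) R) := ⟨0, by simpa using hR⟩
  have hh1 : ∀ (w : StrongDual ℝ E) (y : E), ‖w‖ ≤ R → w y - g w ≤ h y := by
    intro w y hw
    refine le_ciSup (f := fun w : Metric.closedBall (0 : StrongDual ℝ E) R => w.1 y - g w.1)
      ⟨R * ‖y‖ + R * M - φ z₀, ?_⟩ ⟨w, by simpa using hw⟩
    rintro _ ⟨w, rfl⟩
    exact hlow _ _ (mem_closedBall_zero_iff.1 w.2)
  have hh2 : ∀ (y : E) (a : ℝ), (∀ w : StrongDual ℝ E, ‖w‖ ≤ R → w y - g w ≤ a) → h y ≤ a :=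
    fun y a ha => ciSup_le fun w => ha _ (mem_closedBall_zero_iff.1 w.2)
  refine ⟨g, h, ⟨convex_univ, ?_⟩, ?_, hg, hh1, ?_, K + R * M, ?_⟩
  · intro x _ y _ a b ha hb hab
    refine hh2 _ _ fun w hw => ?_
    have h1 := mul_le_mul_of_nonneg_left (hh1 w x hw) ha
    have h2 := mul_le_mul_of_nonneg_left (hh1 w y hw) hb
    have h3 : g w = a * g w + b * g w := by rw [← add_mul, hab, one_mul]
    simp only [map_add, map_smul, smul_eq_mul]
    linarith
  · refine (LipschitzWith.of_le_add_mul ⟨R, hR⟩ fun x y => hh2 _ _ fun w hw => ?_).continuous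
    have h1 := hh1 w y hw
    have h2 : w (x - y) ≤ R * ‖x - y‖ := (le_abs_self _).trans (w.le_of_opNorm_le hw _)
    rw [map_sub] at h2
    rw [dist_eq_norm]
    change _ ≤ _ + R * _
    linarith
  · exact fun z hz => hh2 _ _ fun w _ => by linarith [hgle w z hz]
  · intro w hw
    refine (hg w).2 ?_
    rintro _ ⟨z, hz, rfl⟩
    exact (hup w z hz).trans (by gcongr)

/-- An approximate form of **Stegall's variational principle**: if every bounded subset of `E` is
dentable, a function bounded above on a bounded set acquires slices of arbitrarily small diameter
after an arbitrarily small linear perturbation.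

Dentability is applied to the set `A` of points at which the convex function `h` conjugate to `-φ`
has a subgradient of norm less than `η`. If `f` determines a small slice of `A` containing
`y ∈ A`, with subgradient `w` at `y`, then by monotonicity of the subdifferential the subgradients
near `w + t • f` occur only in that slice, and by Ekeland's principle the near-maximizers of
`φ + (w + t • f)` are close to points with such subgradients. -/
theorem exists_small_slice_add {E : Type*} [NormedAddCommGroup E] [NormedSpace ℝ E]
    [CompleteSpace E] (hE : HasRNP ℝ E) {C : Set E} (hne : C.Nonempty)
    (hC : Bornology.IsBounded C) {φ : E → ℝ} (hφ : BddAbove (φ '' C)) {η ε : ℝ} (hη : 0 < η)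
    (hε : 0 < ε) :
    ∃ w : StrongDual ℝ E, ‖w‖ < η ∧ ∃ α : ℝ, (∃ z ∈ C, α < φ z + w z) ∧
      ∀ z₁ ∈ C, ∀ z₂ ∈ C, α < φ z₁ + w z₁ → α < φ z₂ + w z₂ → dist z₁ z₂ < ε := by
  obtain ⟨g, h, hconv, hcont, hg, hgh, hhφ, K, hK⟩ :=
    exists_convex_conjugate hne hC hφ (R := 2 * η) (by positivity)
  have hnear : ∀ (w : StrongDual ℝ E) (a : ℝ), a < g w → ∃ z ∈ C, a < φ z + w z := by
    intro w a ha
    obtain ⟨_, ⟨z, hz, rfl⟩, hlt, -⟩ := (hg w).exists_between ha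
    exact ⟨z, hz, hlt⟩
  have happrox : ∀ (w : StrongDual ℝ E) (ρ : ℝ), ‖w‖ < η → 0 < ρ → ∀ z ∈ C,
      g w - ρ ^ 2 < φ z + w z → ∃ (z' : E) (u : StrongDual ℝ E), dist z z' ≤ ρ ∧ ‖u‖ ≤ ρ ∧
        ∀ v, h z' + (w + u) (v - z') ≤ h v := by
    intro w ρ hw hρ z hz hzw
    have hFc : Continuous fun v => h v - w v := hcont.sub w.continuous
    have hlow : ∀ v, -g w ≤ h v - w v := fun v => by linarith [hgh w v (by linarith)]
    obtain ⟨z', h1, h2⟩ := exists_ekeland_point hFc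
      ⟨-g w, by rintro _ ⟨v, rfl⟩; exact hlow v⟩ hρ z
    have hFconv : ConvexOn ℝ Set.univ fun v => h v - w v := by
      refine ⟨convex_univ, fun x _ y _ a b ha hb hab => ?_⟩
      have := hconv.2 (Set.mem_univ x) (Set.mem_univ y) ha hb hab
      simp only [map_add, map_smul, smul_eq_mul] at *
      linarith
    obtain ⟨u, hu, hsub⟩ := exists_subgradient_of_le_add hFconv hFc hρ.le (z := z')
      fun v => by simpa [dist_eq_norm] using h2 v
    refine ⟨z', u, ?_, hu, fun v => ?_⟩
    · have h3 := hlow z'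
      have h4 := hhφ z hz
      have h5 : ρ * dist z z' ≤ ρ * ρ := by nlinarith
      exact le_of_mul_le_mul_left h5 hρ
    · have := hsub v
      rw [add_apply, map_sub w]
      linarith
  let A : Set E := {y | ∃ w : StrongDual ℝ E, ‖w‖ < η ∧ ∀ v, h y + w (v - y) ≤ h v}
  have hA : A.Nonempty := by
    obtain ⟨z, hz, hlt⟩ := hnear 0 (g 0 - (η / 2) ^ 2) (by linarith [sq_pos_of_pos (half_pos hη)])
    obtain ⟨z', u, -, hu, hsub⟩ := happrox 0 (η / 2) (by simpa using hη) (half_pos hη) z hz hlt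
    exact ⟨z', u, by linarith, by simpa using hsub⟩
  have hAle : ∀ y ∈ A, ‖y‖ ≤ (h 0 + K) / η := by
    rintro y ⟨w, hw, hsub⟩
    obtain ⟨u, hu, huy⟩ := exists_dual_vector'' ℝ y
    have hn : ‖(2 * η) • u‖ ≤ 2 * η := by
      rw [norm_smul, Real.norm_of_nonneg (by positivity)]
      exact mul_le_of_le_one_right (by positivity) hu
    have h1 := hgh _ y hn
    have h2 := hK _ hn
    rw [smul_apply, huy, smul_eq_mul] at h1
    have h3 := hsub 0
    have h4 : w y ≤ η * ‖y‖ := (le_abs_self _).trans (w.le_of_opNorm_le hw.le y)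
    rw [zero_sub, map_neg] at h3
    rw [le_div_iff₀ hη]
    simp only [RCLike.ofReal_real_eq_id, id_eq] at h1
    linarith
  have hAb : Bornology.IsBounded A := isBounded_iff_forall_norm_le.2 ⟨_, hAle⟩
  obtain ⟨f, α, ⟨y, ⟨w, hw, hsub⟩, hy⟩, hslice⟩ := hE A hA hAb (ε / 2) (half_pos hε)
  simp only [RCLike.re_to_real] at hy hslice
  -- The step `t` keeps `w + t • f` in the ball of radius `η`.
  obtain ⟨t, ht, htη⟩ : ∃ t : ℝ, 0 < t ∧ ‖w + t • f‖ < η := by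
    have hc : Continuous fun t : ℝ => ‖w + t • f‖ := by fun_prop
    have : ∀ᶠ t in 𝓝 (0 : ℝ), ‖w + t • f‖ < η :=
      hc.continuousAt.eventually_lt continuousAt_const (by simpa using hw)
    obtain ⟨r, hr, hball⟩ := Metric.eventually_nhds_iff.1 this
    exact ⟨r / 2, half_pos hr, hball (by simp [abs_of_pos hr, hr])⟩
  -- The tolerance `ρ` is small against the margin `f y - α`.
  obtain ⟨ρ, hρ, hρ1, hρ2, hρ3⟩ : ∃ ρ : ℝ, 0 < ρ ∧ ‖w + t • f‖ + ρ < η ∧ ρ < ε / 4 ∧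
      ρ * (2 * ((h 0 + K) / η)) < t * (f y - α) := by
    have e1 : ∀ᶠ ρ in 𝓝 (0 : ℝ), ‖w + t • f‖ + ρ < η :=
      ContinuousAt.eventually_lt (by fun_prop) continuousAt_const (by simpa using htη)
    have e2 : ∀ᶠ ρ in 𝓝 (0 : ℝ), ρ < ε / 4 := eventually_lt_nhds (by positivity)
    have e3 : ∀ᶠ ρ in 𝓝 (0 : ℝ), ρ * (2 * ((h 0 + K) / η)) < t * (f y - α) :=
      ContinuousAt.eventually_lt (by fun_prop) continuousAt_const
        (by simpa using mul_pos ht (sub_pos.2 hy))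
    obtain ⟨r, hr, hball⟩ := Metric.eventually_nhds_iff.1 (e1.and (e2.and e3))
    exact ⟨r / 2, half_pos hr, hball (by simp [abs_of_pos hr, hr])⟩
  have hloc : ∀ z ∈ C, g (w + t • f) - ρ ^ 2 < φ z + (w + t • f) z →
      ∃ z' ∈ A, α < f z' ∧ dist z z' ≤ ρ := by
    intro z hz hlt
    obtain ⟨z', u, hd, hu, hsub'⟩ := happrox _ ρ htη hρ z hz hlt
    have hz'A : z' ∈ A := ⟨w + t • f + u, (norm_add_le _ _).trans_lt (by linarith), hsub'⟩
    refine ⟨z', hz'A, ?_, hd⟩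
    have h1 := hsub z'
    have h2 := hsub' y
    have h3 : u (z' - y) ≤ ρ * (2 * ((h 0 + K) / η)) := by
      refine (le_abs_self _).trans ((u.le_of_opNorm_le hu _).trans ?_)
      refine mul_le_mul_of_nonneg_left ((norm_sub_le _ _).trans ?_) hρ.le
      linarith [hAle y ⟨w, hw, hsub⟩, hAle z' hz'A]
    simp only [add_apply, smul_apply, smul_eq_mul, map_sub] at h1 h2 h3
    have h4 : t * α < t * f z' := by linarith
    exact lt_of_mul_lt_mul_left h4 ht.le
  refine ⟨w + t • f, htη, g (w + t • f) - ρ ^ 2, hnear _ _ (by linarith [sq_pos_of_pos hρ]), ?_⟩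
  intro z₁ hz₁ z₂ hz₂ h₁ h₂
  obtain ⟨a, ha, hfa, hda⟩ := hloc z₁ hz₁ h₁
  obtain ⟨b, hb, hfb, hdb⟩ := hloc z₂ hz₂ h₂
  have := hslice a ha b hb hfa hfb
  have h5 := dist_triangle4 z₁ a b z₂
  rw [dist_comm b z₂] at h5
  linarith

/-! ### Absolutely strongly exposing operators -/

section Exposing

variable {𝕜 : Type*} [RCLike 𝕜]
variable {E F : Type*} [NormedAddCommGroup E] [NormedSpace 𝕜 E]
  [NormedAddCommGroup F] [NormedSpace 𝕜 F]

/-- The operator `S` absolutely strongly exposes the closed unit ball at `y₀`: the points of the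
ball at which `‖S y‖` is almost `‖S‖` are, up to rotation, close to `y₀`. -/
def AbsExposesAt (S : E →L[𝕜] F) (y₀ : E) : Prop :=
  ‖y₀‖ ≤ 1 ∧ ∀ ε : ℝ, 0 < ε → ∃ δ : ℝ, 0 < δ ∧ ∀ y, ‖y‖ ≤ 1 → ‖S‖ - δ < ‖S y‖ →
    ∃ θ : 𝕜, ‖θ‖ = 1 ∧ dist (θ • y) y₀ < ε

variable (𝕜 E F) in
/-- The operators whose almost norm-attaining points in the closed unit ball lie, up to rotation,
in a single ball of radius `ε`. -/
def nearlyExposing (ε : ℝ) : Set (E →L[𝕜] F) :=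
  {S | ∃ (y₀ : E) (δ : ℝ), 0 < δ ∧ ∀ y, ‖y‖ ≤ 1 → ‖S‖ - δ < ‖S y‖ →
    ∃ θ : 𝕜, ‖θ‖ = 1 ∧ dist (θ • y) y₀ < ε}

theorem norm_apply_le_opNorm (S : E →L[𝕜] F) {y : E} (hy : ‖y‖ ≤ 1) : ‖S y‖ ≤ ‖S‖ := by
  simpa using S.le_opNorm_of_le hy

theorem exists_sub_lt_norm_apply (S : E →L[𝕜] F) {δ : ℝ} (hδ : 0 < δ) :
    ∃ y, ‖y‖ ≤ 1 ∧ ‖S‖ - δ < ‖S y‖ := by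
  obtain ⟨y, hy, h⟩ := S.exists_lt_apply_of_lt_opNorm (sub_lt_self ‖S‖ hδ)
  exact ⟨y, hy.le, h⟩

theorem isOpen_nearlyExposing (ε : ℝ) : IsOpen (nearlyExposing 𝕜 E F ε) := by
  refine Metric.isOpen_iff.2 fun S ⟨y₀, δ, hδ, h⟩ => ⟨δ / 3, by positivity, fun S' hS' => ?_⟩
  refine ⟨y₀, δ / 3, by positivity, fun y hy hlt => h y hy ?_⟩
  rw [mem_ball_iff_norm] at hS'
  have h1 : ‖S' y‖ ≤ ‖S y‖ + ‖S' - S‖ := by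
    have := norm_apply_le_opNorm (S' - S) hy
    have e : S' y = S y + (S' - S) y := by simp
    rw [e]
    exact (norm_add_le _ _).trans (by linarith)
  have h2 := norm_sub_norm_le S S'
  rw [norm_sub_rev] at h2
  linarith

theorem dist_smul_left_of_norm_eq_one {θ : 𝕜} (hθ : ‖θ‖ = 1) (a b : E) :
    dist (θ • a) b = dist a (θ⁻¹ • b) := by
  have h0 : θ ≠ 0 := by rintro rfl; simp at hθ
  rw [dist_eq_norm, dist_eq_norm, ← one_mul ‖a - θ⁻¹ • b‖, ← hθ, ← norm_smul, smul_sub,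
    smul_inv_smul₀ h0]

theorem AbsExposesAt.smul {S : E →L[𝕜] F} {y₀ : E} (h : AbsExposesAt S y₀) {θ : 𝕜}
    (hθ : ‖θ‖ = 1) : AbsExposesAt S (θ • y₀) := by
  refine ⟨by rw [norm_smul, hθ, one_mul]; exact h.1, fun ε hε => ?_⟩
  obtain ⟨δ, hδ, H⟩ := h.2 ε hε
  refine ⟨δ, hδ, fun y hy hlt => ?_⟩
  obtain ⟨τ, hτ, hd⟩ := H y hy hlt
  have h0 : θ ≠ 0 := by rintro rfl; simp at hθ
  exact ⟨θ * τ, by simp [hθ, hτ], by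
    rwa [mul_smul, dist_smul_left_of_norm_eq_one hθ, inv_smul_smul₀ h0]⟩

/-- Operators that are nearly exposing to every order expose at a point: rotated near-maximizers
form a Cauchy sequence. -/
theorem exists_absExposesAt [CompleteSpace E] {S : E →L[𝕜] F}
    (hS : ∀ n : ℕ, S ∈ nearlyExposing 𝕜 E F ((1 / 2) ^ n)) : ∃ y₀, AbsExposesAt S y₀ := by
  choose c δ hδ hc using hS
  -- `v n` is almost norm attaining to each of the first `n + 1` orders.
  have hv : ∀ n, ∃ v, ‖v‖ ≤ 1 ∧ ∀ k ≤ n, ‖S‖ - δ k < ‖S v‖ := by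
    intro n
    obtain ⟨k₀, -, hk₀⟩ := (Finset.range (n + 1)).exists_min_image δ ⟨0, by simp⟩
    obtain ⟨v, hv, hlt⟩ := exists_sub_lt_norm_apply S (hδ k₀)
    exact ⟨v, hv, fun k hk => by linarith [hk₀ k (Finset.mem_range_succ_iff.2 hk)]⟩
  choose v hv1 hv2 using hv
  have hclose : ∀ (n : ℕ) (y z : E), ‖y‖ ≤ 1 → ‖z‖ ≤ 1 → ‖S‖ - δ n < ‖S y‖ → ‖S‖ - δ n < ‖S z‖ →
      ∃ θ : 𝕜, ‖θ‖ = 1 ∧ dist z (θ • y) < 2 * (1 / 2) ^ n := by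
    intro n y z hy hz hSy hSz
    obtain ⟨τ, hτ, h1⟩ := hc n y hy hSy
    obtain ⟨σ, hσ, h2⟩ := hc n z hz hSz
    refine ⟨σ⁻¹ * τ, by simp [hσ, hτ], ?_⟩
    rw [mul_smul, ← dist_smul_left_of_norm_eq_one hσ]
    have := dist_triangle_right (σ • z) (τ • y) (c n)
    linarith
  have hstep : ∀ (n : ℕ) (z : E), ∃ w : E, (‖z‖ ≤ 1 → ‖S‖ - δ n < ‖S z‖ →
      dist z w < 2 * (1 / 2) ^ n ∧ ‖w‖ ≤ 1 ∧ ∀ k ≤ n + 1, ‖S‖ - δ k < ‖S w‖) := by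
    intro n z
    by_cases hz : ‖z‖ ≤ 1 ∧ ‖S‖ - δ n < ‖S z‖
    · obtain ⟨θ, hθ, hd⟩ := hclose n (v (n + 1)) z (hv1 _) hz.1 (hv2 _ _ n.le_succ) hz.2
      refine ⟨θ • v (n + 1), fun _ _ => ⟨hd, ?_, fun k hk => ?_⟩⟩
      · rw [norm_smul, hθ, one_mul]; exact hv1 _
      · rw [map_smul, norm_smul, hθ, one_mul]; exact hv2 _ _ hk
    · exact ⟨0, fun h1 h2 => absurd ⟨h1, h2⟩ hz⟩
  choose next hnext using hstep
  let u : ℕ → E := fun n => Nat.rec (v 0) (fun k z => next k z) n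
  have hu : ∀ n, ‖u n‖ ≤ 1 ∧ ‖S‖ - δ n < ‖S (u n)‖ := by
    intro n
    induction n with
    | zero => exact ⟨hv1 0, hv2 0 0 le_rfl⟩
    | succ n ih =>
      obtain ⟨-, h1, h2⟩ := hnext n (u n) ih.1 ih.2
      exact ⟨h1, h2 _ le_rfl⟩
  have hdist : ∀ n, dist (u n) (u (n + 1)) ≤ 4 / 2 / 2 ^ n := by
    intro n
    refine (hnext n (u n) (hu n).1 (hu n).2).1.le.trans (le_of_eq ?_)
    rw [one_div, inv_pow, div_eq_mul_inv (4 / 2 : ℝ)]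
    norm_num
  obtain ⟨y₀, hy₀⟩ := cauchySeq_tendsto_of_complete (cauchySeq_of_le_geometric_two hdist)
  refine ⟨y₀, le_of_tendsto hy₀.norm (Eventually.of_forall fun n => (hu n).1), fun ε hε => ?_⟩
  have hlim : Tendsto (fun n : ℕ => 2 * (1 / 2 : ℝ) ^ n + dist (u n) y₀) atTop (𝓝 0) := by
    have h1 := (tendsto_pow_atTop_nhds_zero_of_lt_one (by norm_num : (0 : ℝ) ≤ 1 / 2)
      (by norm_num)).const_mul 2
    simpa using h1.add (tendsto_iff_dist_tendsto_zero.1 hy₀)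
  obtain ⟨n, hn⟩ := (hlim.eventually_lt_const hε).exists
  refine ⟨δ n, hδ n, fun y hy hlt => ?_⟩
  obtain ⟨θ, hθ, hd⟩ := hclose n y (u n) hy (hu n).1 hlt (hu n).2
  refine ⟨θ, hθ, ?_⟩
  have := dist_triangle_left (θ • y) y₀ (u n)
  linarith

theorem AbsExposesAt.norm_apply {S : E →L[𝕜] F} {y₀ : E} (h : AbsExposesAt S y₀) :
    ‖S y₀‖ = ‖S‖ := by
  refine le_antisymm (norm_apply_le_opNorm S h.1) (le_of_forall_pos_lt_add fun e he => ?_)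
  have hN : 0 < ‖S‖ + 1 := by positivity
  obtain ⟨δ, hδ, H⟩ := h.2 (e / 2 / (‖S‖ + 1)) (by positivity)
  obtain ⟨y, hy, hlt⟩ := exists_sub_lt_norm_apply S (lt_min hδ (half_pos he))
  obtain ⟨θ, hθ, hd⟩ := H y hy ((sub_le_sub_left (min_le_left _ _) _).trans_lt hlt)
  have h1 : ‖S y‖ = ‖S (θ • y)‖ := by rw [map_smul, norm_smul, hθ, one_mul]
  have h2 : ‖S (θ • y)‖ ≤ ‖S y₀‖ + ‖S (θ • y - y₀)‖ := by
    rw [map_sub]; exact norm_le_norm_add_norm_sub' _ _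
  have h3 := S.le_opNorm (θ • y - y₀)
  rw [dist_eq_norm, lt_div_iff₀ hN] at hd
  have h4 := min_le_right δ (e / 2)
  nlinarith [norm_nonneg (θ • y - y₀)]

/-- If `S` were zero, every point of the unit ball would be maximizing, hence of norm `‖y₀‖`. -/
theorem AbsExposesAt.norm_pos [Nontrivial E] {S : E →L[𝕜] F} {y₀ : E} (h : AbsExposesAt S y₀) :
    0 < ‖S‖ := by
  by_contra! h0
  have hS : ‖S‖ = 0 := le_antisymm h0 (norm_nonneg S)
  have hall : ∀ y : E, ‖y‖ ≤ 1 → ‖y‖ = ‖y₀‖ := by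
    intro y hy
    refine eq_of_forall_dist_le fun ε hε => ?_
    obtain ⟨δ, hδ, H⟩ := h.2 ε hε
    obtain ⟨θ, hθ, hd⟩ := H y hy (by linarith [norm_nonneg (S y)])
    have h1 : ‖θ • y‖ = ‖y‖ := by rw [norm_smul, hθ, one_mul]
    rw [← h1]
    exact (dist_norm_norm_le _ _).trans (by rw [← dist_eq_norm]; exact hd.le)
  obtain ⟨y, hy⟩ := exists_ne (0 : E)
  have hn : ‖((‖y‖ : 𝕜)⁻¹) • y‖ = 1 := by
    rw [norm_smul, norm_inv, RCLike.norm_ofReal, abs_norm, inv_mul_cancel₀ (norm_ne_zero_iff.2 hy)]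
  have h1 := hall _ hn.le
  have h2 := hall 0 (by simp)
  rw [hn] at h1
  rw [norm_zero] at h2
  linarith

theorem AbsExposesAt.norm_eq_one [Nontrivial E] {S : E →L[𝕜] F} {y₀ : E} (h : AbsExposesAt S y₀) :
    ‖y₀‖ = 1 := by
  refine le_antisymm h.1 ?_
  have := S.le_opNorm y₀
  rw [h.norm_apply] at this
  exact (le_mul_iff_one_le_right h.norm_pos).1 this

/-- Along a maximizing sequence, the best rotations exist because the scalars of modulus one form
a compact set. -/
theorem AbsExposesAt.exists_tendsto {S : E →L[𝕜] F} {y₀ : E} (h : AbsExposesAt S y₀) {u : ℕ → E}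
    (hu : ∀ n, ‖u n‖ ≤ 1) (hlim : Tendsto (fun n => ‖S (u n)‖) atTop (𝓝 ‖S‖)) :
    ∃ θ : ℕ → 𝕜, (∀ n, ‖θ n‖ = 1) ∧ Tendsto (fun n => θ n • u n) atTop (𝓝 y₀) := by
  have hmin : ∀ n, ∃ θ : 𝕜, ‖θ‖ = 1 ∧ ∀ τ : 𝕜, ‖τ‖ = 1 → dist (θ • u n) y₀ ≤ dist (τ • u n) y₀ := by
    intro n
    obtain ⟨θ, hθ, H⟩ := (isCompact_sphere (0 : 𝕜) 1).exists_isMinOn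
      ⟨1, by simp⟩ (f := fun θ => dist (θ • u n) y₀) (by fun_prop)
    exact ⟨θ, by simpa using hθ, fun τ hτ => H (by simpa using hτ)⟩
  choose θ hθ hle using hmin
  refine ⟨θ, hθ, Metric.tendsto_nhds.2 fun ε hε => ?_⟩
  obtain ⟨δ, hδ, H⟩ := h.2 ε hε
  filter_upwards [hlim.eventually_const_lt (sub_lt_self ‖S‖ hδ)] with n hn
  obtain ⟨τ, hτ, hd⟩ := H (u n) (hu n) hn
  exact (hle n τ hτ).trans_lt hd

theorem AbsExposesAt.mem_ASE {S : E →L[𝕜] F} {y₀ : E} (h : AbsExposesAt S y₀) :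
    S ∈ ASE 𝕜 E F :=
  ⟨y₀, by simpa using h.1, fun _ hu hlim =>
    h.exists_tendsto (fun n => by simpa using hu n) hlim⟩

/-- If `a` has modulus at most `N` and real part almost `N`, a rotation `θ` keeping `a` close to
`N` is close to `1`. -/
theorem exists_pos_norm_sub_one_lt {N ε : ℝ} (hN : 0 < N) (hε : 0 < ε) :
    ∃ δ : ℝ, 0 < δ ∧ ∀ a θ : 𝕜, ‖a‖ ≤ N → N - δ < RCLike.re a → ‖θ‖ = 1 →
      ‖θ * a - (N : 𝕜)‖ < δ → ‖θ - 1‖ < ε := by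
  refine ⟨min (N * ε ^ 2 / 32) (N * ε / 4), by positivity, fun a θ ha hre hθ hd => ?_⟩
  have h1 : ‖a - (N : 𝕜)‖ ≤ N * ε / 4 := by
    refine abs_le_of_sq_le_sq' ?_ (by positivity) |>.2
    have e : ‖a - (N : 𝕜)‖ ^ 2 = ‖a‖ ^ 2 - 2 * N * RCLike.re a + N ^ 2 := by
      rw [RCLike.norm_sq_eq_def, RCLike.norm_sq_eq_def]
      simp only [map_sub, RCLike.ofReal_re, RCLike.ofReal_im]
      ring
    rw [e]
    have h2 : ‖a‖ ^ 2 ≤ N ^ 2 := by gcongr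
    have h3 := min_le_left (N * ε ^ 2 / 32) (N * ε / 4)
    have h4 : N * (N - RCLike.re a) ≤ N * (N * ε ^ 2 / 32) :=
      mul_le_mul_of_nonneg_left (by linarith) hN.le
    linarith
  have h5 : ‖θ - 1‖ * N ≤ N * ε / 4 + N * ε / 4 := by
    have e : (θ - 1) * (N : 𝕜) = (θ * a - (N : 𝕜)) - θ * (a - (N : 𝕜)) := by ring
    have e' : ‖(θ - 1) * (N : 𝕜)‖ = ‖θ - 1‖ * N := by
      rw [norm_mul, RCLike.norm_ofReal, abs_of_pos hN]
    rw [← e', e]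
    refine (norm_sub_le _ _).trans ?_
    rw [norm_mul, hθ, one_mul]
    linarith [min_le_right (N * ε ^ 2 / 32) (N * ε / 4)]
  nlinarith

/-- Composing `S` with a functional that norms `S y₀` gives a functional strongly exposing the
unit ball at `y₀`. -/
theorem AbsExposesAt.mem_strongExp [Nontrivial E] {S : E →L[𝕜] F} {y₀ : E}
    (h : AbsExposesAt S y₀) : y₀ ∈ strongExp 𝕜 (Metric.closedBall (0 : E) 1) := by
  obtain ⟨g, hg, hgy⟩ := exists_dual_vector'' 𝕜 (S y₀)
  rw [h.norm_apply] at hgy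
  have hgS : ∀ y, ‖g (S y)‖ ≤ ‖S y‖ := fun y => by
    simpa using g.le_of_opNorm_le hg (S y)
  have hval : RCLike.re (g (S y₀)) = ‖S‖ := by rw [hgy, RCLike.ofReal_re]
  refine ⟨g.comp S, by simpa using h.1, fun y hy => ?_, fun u hu hlim => ?_⟩
  · rw [ContinuousLinearMap.comp_apply, ContinuousLinearMap.comp_apply, hval]
    exact (RCLike.re_le_norm _).trans ((hgS y).trans
      (norm_apply_le_opNorm S (by simpa using hy)))
  simp only [ContinuousLinearMap.comp_apply, hval] at hlim
  have hu1 : ∀ n, ‖u n‖ ≤ 1 := fun n => by simpa using hu n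
  have hSu : Tendsto (fun n => ‖S (u n)‖) atTop (𝓝 ‖S‖) :=
    tendsto_of_tendsto_of_tendsto_of_le_of_le hlim tendsto_const_nhds
      (fun n => (RCLike.re_le_norm _).trans (hgS _)) (fun n => norm_apply_le_opNorm S (hu1 n))
  obtain ⟨θ, hθ, hθu⟩ := h.exists_tendsto hu1 hSu
  have hθ1 : Tendsto θ atTop (𝓝 1) := by
    refine Metric.tendsto_nhds.2 fun ε hε => ?_
    obtain ⟨δ, hδ, H⟩ := exists_pos_norm_sub_one_lt (𝕜 := 𝕜) h.norm_pos hε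
    have h1 : Tendsto (fun n => g (S (θ n • u n))) atTop (𝓝 (‖S‖ : 𝕜)) := by
      rw [← hgy]
      exact ((g.comp S).continuous.tendsto y₀).comp hθu
    filter_upwards [hlim.eventually_const_lt (sub_lt_self ‖S‖ hδ), Metric.tendsto_nhds.1 h1 δ hδ]
      with n hn hn'
    rw [dist_eq_norm, map_smul, map_smul, smul_eq_mul] at hn'
    rw [dist_eq_norm]
    exact H _ _ ((hgS _).trans (norm_apply_le_opNorm S (hu1 n))) hn (hθ n) hn'
  have h2 := (hθ1.inv₀ one_ne_zero).smul hθu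
  rw [inv_one, one_smul] at h2
  refine h2.congr fun n => inv_smul_smul₀ ?_ _
  intro h0
  simpa [h0] using hθ n

theorem IsDiscreteUpToRotations.exists_radius {A : Set E} (hA : IsDiscreteUpToRotations 𝕜 A)
    {a : E} (ha : a ∈ A) :
    ∃ r : ℝ, 0 < r ∧ ∀ b ∈ A, dist b a < r → ∃ θ : 𝕜, ‖θ‖ = 1 ∧ b = θ • a := by
  by_contra! H
  choose b hbA hb hne using fun n : ℕ => H (1 / (n + 1)) (by positivity)
  have hlim : Tendsto b atTop (𝓝 a) := tendsto_iff_dist_tendsto_zero.2 <|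
    squeeze_zero (fun _ => dist_nonneg) (fun n => (hb n).le) tendsto_one_div_add_atTop_nhds_zero_nat
  obtain ⟨n, θ, hθ, h⟩ := (hA b a hbA ha hlim).exists
  exact hne n θ hθ h

/-- The point exposed by an operator is, up to rotation, a locally constant function of the
operator. -/
theorem AbsExposesAt.exists_radius [Nontrivial E]
    (hdisc : IsDiscreteUpToRotations 𝕜 (strongExp 𝕜 (Metric.closedBall (0 : E) 1)))
    {S : E →L[𝕜] F} {y₀ : E} (h : AbsExposesAt S y₀) :
    ∃ ρ : ℝ, 0 < ρ ∧ ∀ (S' : E →L[𝕜] F) (y : E), ‖S' - S‖ < ρ → AbsExposesAt S' y →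
      ∃ θ : 𝕜, ‖θ‖ = 1 ∧ y = θ • y₀ := by
  obtain ⟨r, hr, hr'⟩ := hdisc.exists_radius h.mem_strongExp
  obtain ⟨δ, hδ, H⟩ := h.2 r hr
  refine ⟨δ / 2, half_pos hδ, fun S' y hS' hy => ?_⟩
  have h1 : ‖S' y‖ ≤ ‖S y‖ + ‖S' - S‖ := by
    have := norm_apply_le_opNorm (S' - S) hy.1
    have e : S' y = S y + (S' - S) y := by simp
    rw [e]
    exact (norm_add_le _ _).trans (by linarith)
  have h2 := norm_sub_norm_le S S'
  rw [norm_sub_rev] at h2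
  rw [hy.norm_apply] at h1
  obtain ⟨τ, hτ, hd⟩ := H y hy.1 (by linarith)
  obtain ⟨σ, hσ, he⟩ := hr' _ (hy.smul hτ).mem_strongExp hd
  have h0 : τ ≠ 0 := by rintro rfl; simp at hτ
  refine ⟨τ⁻¹ * σ, by simp [hτ, hσ], ?_⟩
  rw [mul_smul, ← he, inv_smul_smul₀ h0]

end Exposing

/-! ### Density of exposing operators in an operator ideal -/

theorem HasRNP.restrictScalars_real {𝕜 : Type*} [RCLike 𝕜] {Y : Type*} [NormedAddCommGroup Y]
    [NormedSpace 𝕜 Y] [NormedSpace ℝ Y] [IsScalarTower ℝ 𝕜 Y] (h : HasRNP 𝕜 Y) :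
    HasRNP ℝ Y := by
  intro C hne hC ε hε
  obtain ⟨f, α, hf, hslice⟩ := h C hne hC ε hε
  exact ⟨RCLike.reCLM.comp (f.restrictScalars ℝ), α, hf, hslice⟩

theorem IsClosed.baireSpace_coe {V : Type*} [PseudoMetricSpace V] [CompleteSpace V] {s : Set V}
    (hs : IsClosed s) : BaireSpace s := by
  have : CompleteSpace s := hs.completeSpace_coe
  infer_instance

section Operators

-- The normed structure of operators with values in a dual space needs a deeper instance search.
set_option maxSynthPendingDepth 3

variable {𝕜 : Type*} [RCLike 𝕜]
variable {X Y : Type*} [NormedAddCommGroup X] [NormedSpace 𝕜 X]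
  [NormedAddCommGroup Y] [NormedSpace 𝕜 Y]

theorem exists_norm_one_smul_eq {V : Type*} [NormedAddCommGroup V] [NormedSpace 𝕜 V]
    [Nontrivial V] (v : V) : ∃ f : V, ‖f‖ = 1 ∧ (‖v‖ : 𝕜) • f = v := by
  have hunit : ∀ u : V, u ≠ 0 → ‖(‖u‖ : 𝕜)⁻¹ • u‖ = 1 := fun u hu => by
    rw [norm_smul, norm_inv, RCLike.norm_ofReal, abs_norm, inv_mul_cancel₀ (norm_ne_zero_iff.2 hu)]
  by_cases hv : v = 0
  · obtain ⟨u, hu⟩ := exists_ne (0 : V)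
    exact ⟨_, hunit u hu, by simp [hv]⟩
  · refine ⟨_, hunit v hv, smul_inv_smul₀ ?_ v⟩
    simpa using hv

/-- A small rank-one perturbation turns the transpose of `T` into a nearly exposing operator.

The variational principle for `φ y = ‖T.flip y‖` gives a small functional `g` on `Y` such that
`φ + Re g` has a small slice on the unit ball. The norm-one functional `f` is chosen aligned with
`T.flip z`, for a rotation `z` of a point of that slice, so that the norm of
`T.flip z + g z • f` is `φ z + ‖g z‖`, while `φ y + ‖g y‖` is an upper bound at every `y`. -/
theorem exists_smulRight_add_flip_mem_nearlyExposing [CompleteSpace Y] [Nontrivial X]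
    (hRNP : HasRNP 𝕜 Y) (T : X →L[𝕜] StrongDual 𝕜 Y) {η ε : ℝ} (hη : 0 < η) (hε : 0 < ε) :
    ∃ (f : StrongDual 𝕜 X) (g : StrongDual 𝕜 Y), ‖f.smulRight g‖ < η ∧
      (T + f.smulRight g).flip ∈ nearlyExposing 𝕜 Y (StrongDual 𝕜 X) ε := by
  let _ : NormedSpace ℝ Y := NormedSpace.restrictScalars ℝ 𝕜 Y
  have : IsScalarTower ℝ 𝕜 Y := RestrictScalars.isScalarTower ℝ 𝕜 Y
  obtain ⟨w, hw, α, ⟨z, hz, hαz⟩, hslice⟩ := exists_small_slice_add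
    hRNP.restrictScalars_real (C := Metric.closedBall (0 : Y) 1) ⟨0, by simp⟩
    Metric.isBounded_closedBall (φ := fun y => ‖T.flip y‖)
    ⟨‖T.flip‖, by
      rintro _ ⟨y, hy, rfl⟩
      exact norm_apply_le_opNorm T.flip (by simpa using hy)⟩ hη hε
  let g : StrongDual 𝕜 Y := w.extendRCLike
  have hg : ∀ y, RCLike.re (g y) = w y := fun y => StrongDual.re_extendRCLike_apply w y
  have hrot : ∀ y, ‖y‖ ≤ 1 → ∃ θ : 𝕜, ‖θ‖ = 1 ∧ ‖θ • y‖ ≤ 1 ∧ ‖T.flip (θ • y)‖ = ‖T.flip y‖ ∧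
      g (θ • y) = (‖g y‖ : 𝕜) := by
    intro y hy
    obtain ⟨θ, hθ, h⟩ := RCLike.exists_norm_eq_mul_self (g y)
    refine ⟨θ, hθ, by rwa [norm_smul, hθ, one_mul], by rw [map_smul, norm_smul, hθ, one_mul], ?_⟩
    rw [map_smul, smul_eq_mul, ← h]
  have hz1 : ‖z‖ ≤ 1 := by simpa using hz
  obtain ⟨τ, hτ, hτz, hφτ, hgτ⟩ := hrot z hz1
  have : Nontrivial (StrongDual 𝕜 X) := by
    obtain ⟨f, hf, -⟩ := exists_dual_vector' 𝕜 (0 : X)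
    exact ⟨f, 0, by rintro rfl; simp at hf⟩
  obtain ⟨f, hf, hfz⟩ := exists_norm_one_smul_eq (𝕜 := 𝕜) (T.flip (τ • z))
  have happ : ∀ y, (T + f.smulRight g).flip y = T.flip y + g y • f := by
    intro y
    ext x
    simp [mul_comm]
  refine ⟨f, g, ?_, z, ‖T.flip z‖ + w z - α, by linarith, fun y hy hlt => ?_⟩
  · rw [ContinuousLinearMap.norm_smulRight_apply, hf, one_mul]
    exact (StrongDual.norm_extendRCLike (𝕜 := 𝕜) w).trans_lt hw
  have h1 : ‖T.flip z‖ + w z ≤ ‖(T + f.smulRight g).flip‖ := by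
    refine le_trans ?_ (norm_apply_le_opNorm _ hτz)
    rw [happ, hgτ, ← hfz, ← add_smul, norm_smul, hf, mul_one, ← RCLike.ofReal_add,
      RCLike.norm_ofReal, abs_of_nonneg (by positivity), hφτ, ← hg]
    gcongr
    exact RCLike.re_le_norm _
  have h2 : ‖(T + f.smulRight g).flip y‖ ≤ ‖T.flip y‖ + ‖g y‖ := by
    rw [happ]
    refine (norm_add_le _ _).trans ?_
    rw [norm_smul, hf, mul_one]
  obtain ⟨θ, hθ, hθy, hφθ, hgθ⟩ := hrot y hy
  refine ⟨θ, hθ, hslice _ (by simpa using hθy) z hz ?_ hαz⟩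
  rw [hφθ, ← hg, hgθ, RCLike.ofReal_re]
  linarith

theorem continuous_flip : Continuous fun T : X →L[𝕜] StrongDual 𝕜 Y => T.flip :=
  (ContinuousLinearMap.flipₗᵢ 𝕜 X Y 𝕜).continuous

theorem exists_absExposesAt_flip_mem_residual [CompleteSpace Y] [Nontrivial X]
    (hRNP : HasRNP 𝕜 Y) (I : Submodule 𝕜 (X →L[𝕜] StrongDual 𝕜 Y))
    (hIrank : ∀ (f : StrongDual 𝕜 X) (g : StrongDual 𝕜 Y), f.smulRight g ∈ I) :
    {T : I | ∃ y₀, AbsExposesAt (T : X →L[𝕜] StrongDual 𝕜 Y).flip y₀} ∈ residual I := by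
  have hcont : Continuous fun T : I => (T : X →L[𝕜] StrongDual 𝕜 Y).flip :=
    continuous_flip.comp continuous_subtype_val
  have hopen : ∀ n : ℕ, IsOpen {T : I | (T : X →L[𝕜] StrongDual 𝕜 Y).flip ∈
      nearlyExposing 𝕜 Y (StrongDual 𝕜 X) ((1 / 2) ^ n)} := fun n =>
    (isOpen_nearlyExposing (𝕜 := 𝕜) (E := Y) (F := StrongDual 𝕜 X) ((1 / 2) ^ n)).preimage hcont
  have hdense : ∀ n : ℕ, Dense {T : I | (T : X →L[𝕜] StrongDual 𝕜 Y).flip ∈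
      nearlyExposing 𝕜 Y (StrongDual 𝕜 X) ((1 / 2) ^ n)} := by
    intro n
    refine Metric.dense_iff.2 fun T η hη => ?_
    obtain ⟨f, g, hfg, hmem⟩ := exists_smulRight_add_flip_mem_nearlyExposing hRNP
      (T : X →L[𝕜] StrongDual 𝕜 Y) hη (show (0 : ℝ) < (1 / 2) ^ n by positivity)
    let P : I := ⟨f.smulRight g, hIrank f g⟩
    refine ⟨T + P, ?_, hmem⟩
    rw [mem_ball_iff_norm, add_sub_cancel_left]
    exact hfg
  have hres : ∀ᶠ T : I in residual I, ∀ n : ℕ, (T : X →L[𝕜] StrongDual 𝕜 Y).flip ∈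
      nearlyExposing 𝕜 Y (StrongDual 𝕜 X) ((1 / 2) ^ n) :=
    eventually_countable_forall.2 fun n => residual_of_dense_open (hopen n) (hdense n)
  filter_upwards [hres] with T hT
  exact exists_absExposesAt hT

/-- If `R` is residual in the dual of `X`, the transpose of a generic operator of `I` exposes the
unit ball of `Y` at a point `y₀` whose image lies in `R`.

The exposed point `y T`, normalized within its class of rotations, is a locally constant function
of `T`, and for fixed `y₀` the map `T ↦ T.flip y₀` is open on `I`, because `I` contains the
rank-one operators. -/
theorem exists_absExposesAt_flip_apply_mem_residual [CompleteSpace Y] [Nontrivial X] [Nontrivial Y]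
    (hRNP : HasRNP 𝕜 Y)
    (hdisc : IsDiscreteUpToRotations 𝕜 (strongExp 𝕜 (Metric.closedBall (0 : Y) 1)))
    (I : Submodule 𝕜 (X →L[𝕜] StrongDual 𝕜 Y))
    (hIclosed : IsClosed (I : Set (X →L[𝕜] StrongDual 𝕜 Y)))
    (hIrank : ∀ (f : StrongDual 𝕜 X) (g : StrongDual 𝕜 Y), f.smulRight g ∈ I)
    {R : Set (StrongDual 𝕜 X)} (hR : R ∈ residual (StrongDual 𝕜 X)) :
    {T : I | ∃ y₀, AbsExposesAt (T : X →L[𝕜] StrongDual 𝕜 Y).flip y₀ ∧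
      (T : X →L[𝕜] StrongDual 𝕜 Y).flip y₀ ∈ R} ∈ residual I := by
  have : BaireSpace I := hIclosed.baireSpace_coe
  let D : Set I := {T : I | ∃ y₀, AbsExposesAt (T : X →L[𝕜] StrongDual 𝕜 Y).flip y₀}
  have hD : D ∈ residual I := exists_absExposesAt_flip_mem_residual hRNP I hIrank
  have hDd : Dense D := dense_of_mem_residual hD
  -- A fixed representative of each class of rotations makes the exposed point locally constant,
  -- and not merely locally constant up to rotation.
  let rot : Setoid Y :=
    { r := fun a b => ∃ θ : 𝕜, ‖θ‖ = 1 ∧ b = θ • a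
      iseqv := ⟨fun a => ⟨1, by simp⟩,
        by
          rintro a _ ⟨θ, hθ, rfl⟩
          exact ⟨θ⁻¹, by simp [hθ], (inv_smul_smul₀ (by rintro rfl; simp at hθ) a).symm⟩,
        by
          rintro a _ _ ⟨θ, hθ, rfl⟩ ⟨τ, hτ, rfl⟩
          exact ⟨τ * θ, by simp [hθ, hτ], by rw [mul_smul]⟩⟩ }
  have hy : ∃ y : I → Y, ∀ T ∈ D, AbsExposesAt (T : X →L[𝕜] StrongDual 𝕜 Y).flip (y T) ∧
      ∃ ρ : ℝ, 0 < ρ ∧ ∀ T' ∈ D, ‖T' - T‖ < ρ → y T' = y T := by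
    choose! c hc using fun (T : I) (hT : T ∈ D) => hT
    refine ⟨fun T => (Quotient.mk rot (c T)).out, fun T hT => ⟨?_, ?_⟩⟩
    · obtain ⟨θ, hθ, h⟩ := Setoid.symm (Quotient.mk_out (s := rot) (c T))
      dsimp only
      rw [h]
      exact (hc T hT).smul hθ
    · obtain ⟨ρ, hρ, H⟩ := (hc T hT).exists_radius hdisc
      refine ⟨ρ, hρ, fun T' hT' hd => ?_⟩
      have hd' : ‖(T' : X →L[𝕜] StrongDual 𝕜 Y).flip - (T : X →L[𝕜] StrongDual 𝕜 Y).flip‖ < ρ := by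
        have e : (T' : X →L[𝕜] StrongDual 𝕜 Y).flip - (T : X →L[𝕜] StrongDual 𝕜 Y).flip =
          ((T' - T : I) : X →L[𝕜] StrongDual 𝕜 Y).flip := by ext; simp
        rw [e, ContinuousLinearMap.opNorm_flip]
        exact hd
      have : Quotient.mk rot (c T) = Quotient.mk rot (c T') :=
        Quotient.sound (H _ _ hd' (hc T' hT'))
      simp only [this]
  obtain ⟨y, hy⟩ := hy
  choose! hexp ρ hρ hconst using hy
  obtain ⟨_, hsub, hG, hdense⟩ := mem_residual.1 hR
  obtain ⟨O, hO, rfl⟩ := hG.eq_iInter_nat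
  have hOd : ∀ n, Dense (O n) := fun n => hdense.mono (Set.iInter_subset _ _)
  have hcont : ∀ y₀ : Y, Continuous fun T : I => (T : X →L[𝕜] StrongDual 𝕜 Y).flip y₀ :=
    fun y₀ => ((ContinuousLinearMap.apply 𝕜 (StrongDual 𝕜 X) y₀).continuous.comp
      continuous_flip).comp continuous_subtype_val
  -- Near `T₀ ∈ D` the exposed point is `y T₀`, so the condition on `T` involves one point of `Y`.
  have hV : (⋂ n, ⋃ T₀ ∈ D, Metric.ball T₀ (ρ T₀) ∩
      {T : I | (T : X →L[𝕜] StrongDual 𝕜 Y).flip (y T₀) ∈ O n}) ∈ residual I := by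
    refine countable_iInter_mem.2 fun n => residual_of_dense_open ?_ ?_
    · exact isOpen_biUnion fun T₀ _ => Metric.isOpen_ball.inter ((hO n).preimage (hcont _))
    refine Metric.dense_iff.2 fun T₁ η hη => ?_
    obtain ⟨T₀, hT₀, hT₀D⟩ := Metric.dense_iff.1 hDd T₁ (η / 2) (half_pos hη)
    have hmin : 0 < min (ρ T₀) (η / 2) := lt_min (hρ T₀ hT₀D) (half_pos hη)
    obtain ⟨f, hf, hfO⟩ := Metric.dense_iff.1 (hOd n)
      ((T₀ : X →L[𝕜] StrongDual 𝕜 Y).flip (y T₀)) _ hmin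
    have hy1 : ‖y T₀‖ = 1 := (hexp T₀ hT₀D).norm_eq_one
    obtain ⟨g, hg, hgy⟩ := exists_dual_vector' 𝕜 (y T₀)
    rw [hy1, RCLike.ofReal_one] at hgy
    -- As `g (y T₀) = 1`, adding this rank-one operator to `T₀` moves the image of `y T₀` to `f`.
    let P : I := ⟨(f - (T₀ : X →L[𝕜] StrongDual 𝕜 Y).flip (y T₀)).smulRight g, hIrank _ _⟩
    have hP : ‖P‖ < min (ρ T₀) (η / 2) := by
      change ‖(f - (T₀ : X →L[𝕜] StrongDual 𝕜 Y).flip (y T₀)).smulRight g‖ < _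
      rw [ContinuousLinearMap.norm_smulRight_apply, hg, mul_one]
      exact mem_ball_iff_norm.1 hf
    refine ⟨T₀ + P, ?_, Set.mem_biUnion hT₀D ⟨?_, ?_⟩⟩
    · rw [mem_ball_iff_norm] at hT₀ ⊢
      have e : T₀ + P - T₁ = (T₀ - T₁) + P := by abel
      rw [e]
      have := min_le_right (ρ T₀) (η / 2)
      exact (norm_add_le _ _).trans_lt (by linarith)
    · rw [mem_ball_iff_norm, add_sub_cancel_left]
      exact hP.trans_le (min_le_left _ _)
    · have e : ((T₀ + P : I) : X →L[𝕜] StrongDual 𝕜 Y).flip (y T₀) = f := by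
        ext x
        simp [P, hgy]
      rw [Set.mem_ofPred_eq, e]
      exact hfO
  filter_upwards [hD, hV] with T hT hTV
  refine ⟨y T, hexp T hT, hsub (Set.mem_iInter.2 fun n => ?_)⟩
  obtain ⟨T₀, hT₀, hball, hmem⟩ := Set.mem_iUnion₂.1 (Set.mem_iInter.1 hTV n)
  rw [hconst T₀ hT₀ T hT (mem_ball_iff_norm.1 hball)]
  exact hmem

/-! ### Strongly exposing functionals and Fréchet differentiability -/

theorem StronglyExposes.exists_pos {f : StrongDual 𝕜 X} {C : Set X} {x₀ : X}
    (h : StronglyExposes f C x₀) {ε : ℝ} (hε : 0 < ε) :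
    ∃ δ : ℝ, 0 < δ ∧ ∀ x ∈ C, RCLike.re (f x₀) - δ < RCLike.re (f x) → dist x x₀ < ε := by
  by_contra! H
  choose u huC hu hne using fun n : ℕ => H (1 / (n + 1)) (by positivity)
  have hlim : Tendsto (fun n => RCLike.re (f (u n))) atTop (𝓝 (RCLike.re (f x₀))) := by
    refine tendsto_of_tendsto_of_tendsto_of_le_of_le (g := fun n : ℕ =>
      RCLike.re (f x₀) - 1 / ((n : ℝ) + 1)) ?_ tendsto_const_nhds (fun n => (hu n).le)
      (fun n => h.2.1 _ (huC n))
    simpa using (tendsto_const_nhds (x := RCLike.re (f x₀))).sub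
      (tendsto_one_div_add_atTop_nhds_zero_nat (𝕜 := ℝ))
  obtain ⟨n, hn⟩ := (Metric.tendsto_nhds.1 (h.2.2 u huC hlim) ε hε).exists
  exact (hne n).not_gt hn

theorem mem_nearlyExposing_of_mem_SE {f : StrongDual 𝕜 X} (hf : f ∈ SE 𝕜 X) {ε : ℝ}
    (hε : 0 < ε) : f ∈ nearlyExposing 𝕜 X 𝕜 ε := by
  obtain ⟨x₀, h⟩ := hf
  obtain ⟨δ, hδ, H⟩ := h.exists_pos hε
  refine ⟨x₀, δ, hδ, fun x hx hlt => ?_⟩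
  obtain ⟨θ, hθ, hθx⟩ := RCLike.exists_norm_eq_mul_self (f x)
  refine ⟨θ, hθ, H _ (by rwa [mem_closedBall_zero_iff, norm_smul, hθ, one_mul]) ?_⟩
  have h1 : RCLike.re (f x₀) ≤ ‖f‖ :=
    (RCLike.re_le_norm _).trans (norm_apply_le_opNorm f (by simpa using h.1))
  rw [map_smul, smul_eq_mul, ← hθx, RCLike.ofReal_re]
  linarith

theorem exists_absExposesAt_mem_residual_of_dense_SE [CompleteSpace X] (h : Dense (SE 𝕜 X)) :
    {f : StrongDual 𝕜 X | ∃ x₀, AbsExposesAt f x₀} ∈ residual (StrongDual 𝕜 X) := by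
  have hres : (⋂ n : ℕ, nearlyExposing 𝕜 X 𝕜 ((1 / 2) ^ n)) ∈ residual (StrongDual 𝕜 X) :=
    countable_iInter_mem.2 fun n => residual_of_dense_open (isOpen_nearlyExposing _)
      (h.mono fun f hf => mem_nearlyExposing_of_mem_SE hf (by positivity))
  filter_upwards [hres] with f hf
  exact exists_absExposesAt fun n => Set.mem_iInter.1 hf n

theorem dense_exists_absExposesAt_of_dense_SE [CompleteSpace X] [CompleteSpace Y] [Nontrivial X]
    [Nontrivial Y] (hRNP : HasRNP 𝕜 Y)
    (hdisc : IsDiscreteUpToRotations 𝕜 (strongExp 𝕜 (Metric.closedBall (0 : Y) 1)))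
    (I : Submodule 𝕜 (X →L[𝕜] StrongDual 𝕜 Y))
    (hIclosed : IsClosed (I : Set (X →L[𝕜] StrongDual 𝕜 Y)))
    (hIrank : ∀ (f : StrongDual 𝕜 X) (g : StrongDual 𝕜 Y), f.smulRight g ∈ I)
    (h : Dense (SE 𝕜 X)) :
    Dense {T : I | ∃ y₀ x₀, AbsExposesAt (T : X →L[𝕜] StrongDual 𝕜 Y).flip y₀ ∧
      AbsExposesAt ((T : X →L[𝕜] StrongDual 𝕜 Y).flip y₀) x₀} := by
  have : BaireSpace I := hIclosed.baireSpace_coe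
  refine (dense_of_mem_residual <| exists_absExposesAt_flip_apply_mem_residual hRNP hdisc I
    hIclosed hIrank (exists_absExposesAt_mem_residual_of_dense_SE h)).mono ?_
  rintro T ⟨y₀, hy₀, x₀, hx₀⟩
  exact ⟨y₀, x₀, hy₀, hx₀⟩

/-- If the transpose of `T` exposes at `y₀` and `T.flip y₀` exposes at `x₀`, then `T` exposes at
`x₀`: where `‖T x‖` is almost maximal, it is almost attained near a rotation of `y₀`. -/
theorem AbsExposesAt.of_flip {T : X →L[𝕜] StrongDual 𝕜 Y} {y₀ : Y} {x₀ : X}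
    (hy : AbsExposesAt T.flip y₀) (hx : AbsExposesAt (T.flip y₀) x₀) : AbsExposesAt T x₀ := by
  refine ⟨hx.1, fun ε hε => ?_⟩
  obtain ⟨δ₁, hδ₁, H₁⟩ := hx.2 ε hε
  rw [hy.norm_apply, T.opNorm_flip] at H₁
  have hN : 0 < ‖T‖ + 1 := by positivity
  obtain ⟨δ₂, hδ₂, H₂⟩ := hy.2 (δ₁ / 2 / (‖T‖ + 1)) (by positivity)
  rw [T.opNorm_flip] at H₂
  have hδ : 0 < min (δ₁ / 2) δ₂ := lt_min (half_pos hδ₁) hδ₂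
  refine ⟨min (δ₁ / 2) δ₂, hδ, fun x hx1 hlt => ?_⟩
  obtain ⟨y, hy1, hy2⟩ := exists_sub_lt_norm_apply (T x) (sub_pos.2 hlt)
  rw [sub_sub_cancel] at hy2
  have h1 : ‖T x y‖ ≤ ‖T.flip y‖ := norm_apply_le_opNorm (T.flip y) hx1
  have h2 := min_le_right (δ₁ / 2) δ₂
  obtain ⟨θ, hθ, hd⟩ := H₂ y hy1 (by linarith)
  refine H₁ x hx1 ?_
  have h3 : ‖T x y‖ = ‖T x (θ • y)‖ := by rw [map_smul, norm_smul, hθ, one_mul]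
  have h4 : ‖T x (θ • y)‖ ≤ ‖T x y₀‖ + ‖T x (θ • y - y₀)‖ := by
    rw [map_sub]; exact norm_le_norm_add_norm_sub' _ _
  have h5 : ‖T x (θ • y - y₀)‖ ≤ ‖T‖ * ‖θ • y - y₀‖ :=
    (T x).le_of_opNorm_le (norm_apply_le_opNorm T hx1) _
  rw [dist_eq_norm, lt_div_iff₀ hN] at hd
  have h6 := min_le_left (δ₁ / 2) δ₂
  have h7 : T.flip y₀ x = T x y₀ := rfl
  rw [h7]
  nlinarith [norm_nonneg (θ • y - y₀)]

/-- **Šmulian's criterion**, for a norming set `B` of functionals: if the functionals of `B` that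
almost norm `v` are close to a fixed `p`, the norm is Fréchet differentiable at `v`, with
derivative `Re p`. -/
theorem normFrechetDifferentiableAt_of_norming {V : Type*} [NormedAddCommGroup V]
    [NormedSpace 𝕜 V] {B : Set (StrongDual 𝕜 V)} (hB : ∀ q ∈ B, ‖q‖ ≤ 1)
    (hnorming : ∀ (w : V) (a : ℝ), a < ‖w‖ → ∃ q ∈ B, a < RCLike.re (q w))
    {p : StrongDual 𝕜 V} (hp : ‖p‖ ≤ 1) {v : V} (hpv : RCLike.re (p v) = ‖v‖)
    (hexp : ∀ ε : ℝ, 0 < ε → ∃ δ : ℝ, 0 < δ ∧ ∀ q ∈ B, ‖v‖ - δ < RCLike.re (q v) → ‖q - p‖ ≤ ε) :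
    NormFrechetDifferentiableAt 𝕜 v := by
  let _ : NormedSpace ℝ V := NormedSpace.restrictScalars ℝ 𝕜 V
  have : IsScalarTower ℝ 𝕜 V := RestrictScalars.isScalarTower ℝ 𝕜 V
  have hle : ∀ q : StrongDual 𝕜 V, ‖q‖ ≤ 1 → ∀ w, RCLike.re (q w) ≤ ‖w‖ := fun q hq w =>
    (RCLike.re_le_norm _).trans (by simpa using q.le_of_opNorm_le hq w)
  suffices HasFDerivAt (fun w : V => ‖w‖) (RCLike.reCLM.comp (p.restrictScalars ℝ)) v from
    this.differentiableAt
  refine .of_isLittleO (Asymptotics.isLittleO_iff.2 fun c hc => ?_)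
  obtain ⟨δ, hδ, H⟩ := hexp (c / 2) (half_pos hc)
  filter_upwards [Metric.ball_mem_nhds v (show 0 < δ / 4 by positivity)] with w hw
  rw [mem_ball_iff_norm] at hw
  change ‖‖w‖ - ‖v‖ - RCLike.re (p (w - v))‖ ≤ _
  rcases eq_or_ne w v with rfl | hne
  · simp
  have hpos : 0 < ‖w - v‖ := norm_pos_iff.2 (sub_ne_zero.2 hne)
  obtain ⟨q, hqB, hq⟩ := hnorming w (‖w‖ - min (c / 2 * ‖w - v‖) (δ / 4))
    (sub_lt_self _ (lt_min (by positivity) (by positivity)))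
  have hqw : RCLike.re (q w) = RCLike.re (q v) + RCLike.re (q (w - v)) := by
    rw [map_sub q, map_sub]; ring
  have hpw : RCLike.re (p w) = RCLike.re (p v) + RCLike.re (p (w - v)) := by
    rw [map_sub p, map_sub]; ring
  have h1 := min_le_left (c / 2 * ‖w - v‖) (δ / 4)
  have h2 := min_le_right (c / 2 * ‖w - v‖) (δ / 4)
  have h3 := hle q (hB q hqB) (w - v)
  have h4 := norm_sub_norm_le v w
  rw [norm_sub_rev] at h4
  have h5 := H q hqB (by linarith)
  have h6 : RCLike.re (q (w - v)) - RCLike.re (p (w - v)) ≤ c / 2 * ‖w - v‖ := by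
    rw [← map_sub, ← sub_apply]
    exact (RCLike.re_le_norm _).trans ((q - p).le_of_opNorm_le h5 _)
  have h7 := hle q (hB q hqB) v
  have h8 := hle p hp w
  rw [Real.norm_eq_abs, abs_le]
  constructor <;> nlinarith

/-- The functional `T ↦ T x y` on operators into the dual of `Y`. -/
noncomputable def evalAt (x : X) (y : Y) : StrongDual 𝕜 (X →L[𝕜] StrongDual 𝕜 Y) :=
  (ContinuousLinearMap.apply 𝕜 𝕜 y).comp (ContinuousLinearMap.apply 𝕜 (StrongDual 𝕜 Y) x)

@[simp]
theorem evalAt_apply (x : X) (y : Y) (T : X →L[𝕜] StrongDual 𝕜 Y) : evalAt x y T = T x y := rfl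

theorem norm_evalAt_le (x : X) (y : Y) : ‖(evalAt x y : StrongDual 𝕜 _)‖ ≤ ‖x‖ * ‖y‖ :=
  ContinuousLinearMap.opNorm_le_bound _ (by positivity) fun T => by
    rw [evalAt_apply]
    exact (T.le_opNorm₂ x y).trans (le_of_eq (by ring))

theorem norm_evalAt_sub_le {x x₀ : X} {y y₀ : Y} (hy : ‖y‖ ≤ 1) (hx₀ : ‖x₀‖ ≤ 1) :
    ‖(evalAt x y - evalAt x₀ y₀ : StrongDual 𝕜 (X →L[𝕜] StrongDual 𝕜 Y))‖ ≤
      dist x x₀ + dist y y₀ := by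
  have e : (evalAt x y - evalAt x₀ y₀ : StrongDual 𝕜 (X →L[𝕜] StrongDual 𝕜 Y)) =
      evalAt (x - x₀) y + evalAt x₀ (y - y₀) := by
    ext T
    simp
  rw [e, dist_eq_norm, dist_eq_norm]
  refine (norm_add_le _ _).trans (add_le_add ?_ ?_)
  · exact (norm_evalAt_le _ _).trans (mul_le_of_le_one_right (norm_nonneg _) hy)
  · exact (norm_evalAt_le _ _).trans (mul_le_of_le_one_left (norm_nonneg _) hx₀)

/-- Evaluations `T ↦ T x y` at points of the unit balls norm the operators; those almost norming
`T` have `x` and `y` close to rotations of `x₀` and `y₀`, and the product of the two rotations is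
almost `1`. -/
theorem AbsExposesAt.normFrechetDifferentiableAt [Nontrivial Y] {T : X →L[𝕜] StrongDual 𝕜 Y}
    {y₀ : Y} {x₀ : X} (hy : AbsExposesAt T.flip y₀) (hx : AbsExposesAt (T.flip y₀) x₀) :
    NormFrechetDifferentiableAt 𝕜 T := by
  -- A rotation of `x₀` makes `T x₀ y₀` real and positive.
  obtain ⟨x₁, hx₁, hval⟩ : ∃ x₁, AbsExposesAt (T.flip y₀) x₁ ∧ T x₁ y₀ = (‖T‖ : 𝕜) := by
    obtain ⟨θ, hθ, h⟩ := RCLike.exists_norm_eq_mul_self (T.flip y₀ x₀)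
    refine ⟨θ • x₀, hx.smul hθ, ?_⟩
    rw [hx.norm_apply, hy.norm_apply, T.opNorm_flip] at h
    rw [h, map_smul]
    rfl
  have hT := hy.of_flip hx₁
  have hN : 0 < ‖T‖ := by rw [← T.opNorm_flip]; exact hy.norm_pos
  have hball : ∀ (x : X) (y : Y), ‖x‖ ≤ 1 → ‖y‖ ≤ 1 →
      ‖(evalAt x y : StrongDual 𝕜 (X →L[𝕜] StrongDual 𝕜 Y))‖ ≤ 1 := fun x y hx hy =>
    (norm_evalAt_le x y).trans (mul_le_one₀ hx (norm_nonneg _) hy)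
  refine normFrechetDifferentiableAt_of_norming
    (B := {q | ∃ (x : X) (y : Y), ‖x‖ ≤ 1 ∧ ‖y‖ ≤ 1 ∧ q = evalAt x y}) ?_ ?_
    (hball x₁ y₀ hx₁.1 hy.1) (by rw [evalAt_apply, hval, RCLike.ofReal_re]) fun ε hε => ?_
  · rintro _ ⟨x, y, h1, h2, rfl⟩
    exact hball x y h1 h2
  · intro S a ha
    obtain ⟨x, hx1, hax⟩ := exists_sub_lt_norm_apply S (sub_pos.2 ha)
    obtain ⟨y, hy1, hay⟩ := exists_sub_lt_norm_apply (S x) (sub_pos.2 hax)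
    obtain ⟨θ, hθ, h⟩ := RCLike.exists_norm_eq_mul_self (S x y)
    refine ⟨_, ⟨x, θ • y, hx1, by rwa [norm_smul, hθ, one_mul], rfl⟩, ?_⟩
    rw [evalAt_apply, map_smul, smul_eq_mul, ← h, RCLike.ofReal_re]
    linarith
  obtain ⟨δ₁, hδ₁, H₁⟩ := exists_pos_norm_sub_one_lt (𝕜 := 𝕜) hN (half_pos hε)
  have hκ : 0 < min (ε / 4) (δ₁ / (2 * ‖T‖)) := lt_min (by positivity) (by positivity)
  obtain ⟨δ₂, hδ₂, H₂⟩ := hT.2 _ hκ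
  obtain ⟨δ₃, hδ₃, H₃⟩ := hy.2 _ hκ
  rw [T.opNorm_flip] at H₃
  refine ⟨min δ₁ (min δ₂ δ₃), by positivity, ?_⟩
  rintro _ ⟨x, y, hx1, hy1, rfl⟩ hlt
  rw [evalAt_apply] at hlt
  have hxy : RCLike.re (T x y) ≤ ‖T x y‖ := RCLike.re_le_norm _
  have ha : ‖T x y‖ ≤ ‖T x‖ := norm_apply_le_opNorm (T x) hy1
  have hb : ‖T x y‖ ≤ ‖T.flip y‖ := norm_apply_le_opNorm (T.flip y) hx1
  have m1 : min δ₁ (min δ₂ δ₃) ≤ δ₁ := min_le_left _ _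
  have m2 : min δ₁ (min δ₂ δ₃) ≤ δ₂ := (min_le_right _ _).trans (min_le_left _ _)
  have m3 : min δ₁ (min δ₂ δ₃) ≤ δ₃ := (min_le_right _ _).trans (min_le_right _ _)
  obtain ⟨θ, hθ, hdx⟩ := H₂ x hx1 (by linarith)
  obtain ⟨τ, hτ, hdy⟩ := H₃ y hy1 (by linarith)
  have hsub : ‖(evalAt (θ • x) (τ • y) - evalAt x₁ y₀ :
      StrongDual 𝕜 (X →L[𝕜] StrongDual 𝕜 Y))‖ < 2 * min (ε / 4) (δ₁ / (2 * ‖T‖)) :=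
    (norm_evalAt_sub_le (by rwa [norm_smul, hτ, one_mul]) hx₁.1).trans_lt (by linarith)
  have hrot : (evalAt (θ • x) (τ • y) : StrongDual 𝕜 (X →L[𝕜] StrongDual 𝕜 Y)) =
      (θ * τ) • evalAt x y := by
    ext S
    simp
    ring
  have hθτ : ‖θ * τ‖ = 1 := by rw [norm_mul, hθ, hτ, one_mul]
  have hone : ‖θ * τ - 1‖ < ε / 2 := by
    refine H₁ (T x y) _ (ha.trans (norm_apply_le_opNorm T hx1)) (by linarith) hθτ ?_
    have e : θ * τ * T x y - (‖T‖ : 𝕜) = (evalAt (θ • x) (τ • y) - evalAt x₁ y₀ :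
        StrongDual 𝕜 (X →L[𝕜] StrongDual 𝕜 Y)) T := by
      rw [hrot, sub_apply, smul_apply, evalAt_apply, evalAt_apply, hval, smul_eq_mul]
    rw [e]
    refine (ContinuousLinearMap.le_opNorm _ T).trans_lt ?_
    refine (mul_lt_mul_of_pos_right hsub hN).trans_le ?_
    have := mul_le_mul_of_nonneg_right (min_le_right (ε / 4) (δ₁ / (2 * ‖T‖)))
      (mul_pos two_pos hN).le
    rw [div_mul_cancel₀ _ (by positivity)] at this
    linarith
  have e : (evalAt x y - evalAt x₁ y₀ : StrongDual 𝕜 (X →L[𝕜] StrongDual 𝕜 Y)) =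
      (evalAt (θ • x) (τ • y) - evalAt x₁ y₀) - (θ * τ - 1) • evalAt x y := by
    rw [hrot]
    ext S
    simp only [sub_apply, smul_apply, evalAt_apply, smul_eq_mul]
    ring
  rw [e]
  refine (norm_sub_le _ _).trans ?_
  rw [norm_smul]
  have h1 : ‖θ * τ - 1‖ * ‖(evalAt x y : StrongDual 𝕜 (X →L[𝕜] StrongDual 𝕜 Y))‖ ≤ ‖θ * τ - 1‖ :=
    mul_le_of_le_one_right (norm_nonneg _) (hball x y hx1 hy1)
  linarith [min_le_left (ε / 4) (δ₁ / (2 * ‖T‖))]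

theorem normFrechetDifferentiableAt_of_subsingleton {V : Type*} [NormedAddCommGroup V]
    [NormedSpace 𝕜 V] [Subsingleton V] (v : V) : NormFrechetDifferentiableAt 𝕜 v := by
  let _ : NormedSpace ℝ V := NormedSpace.restrictScalars ℝ 𝕜 V
  exact (hasFDerivAt_of_subsingleton (fun w : V => ‖w‖) v).differentiableAt

end Operators

theorem mainTheorem8 {𝕜 : Type*} [RCLike 𝕜]
    {X : Type*} [NormedAddCommGroup X] [NormedSpace 𝕜 X] [CompleteSpace X]
    {Y : Type*} [NormedAddCommGroup Y] [NormedSpace 𝕜 Y] [CompleteSpace Y]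
    (hRNP : HasRNP 𝕜 Y)
    (hdisc : IsDiscreteUpToRotations 𝕜 (strongExp 𝕜 (Metric.closedBall (0 : Y) 1)))
    (I : Submodule 𝕜 (X →L[𝕜] StrongDual 𝕜 Y))
    (hIclosed : IsClosed (I : Set (X →L[𝕜] StrongDual 𝕜 Y)))
    (hIrank : ∀ (f : StrongDual 𝕜 X) (g : StrongDual 𝕜 Y), f.smulRight g ∈ I) :
    (NA 𝕜 X 𝕜 ∈ residual (X →L[𝕜] 𝕜) →
      {T : I | (T : X →L[𝕜] StrongDual 𝕜 Y) ∈ NA 𝕜 X (StrongDual 𝕜 Y)} ∈ residual I) ∧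
    (Dense (SE 𝕜 X) →
      Dense {T : I | NormFrechetDifferentiableAt 𝕜 (T : X →L[𝕜] StrongDual 𝕜 Y)} ∧
      (Nontrivial Y →
        Dense {T : I | (T : X →L[𝕜] StrongDual 𝕜 Y) ∈ ASE 𝕜 X (StrongDual 𝕜 Y)})) := by
  refine ⟨fun hNA => ?_, fun hSE => ?_⟩
  · obtain ⟨f, x₁, hx₁, -⟩ := (dense_of_mem_residual hNA).nonempty
    have : Nontrivial X := ⟨x₁, 0, by rintro rfl; simp at hx₁⟩
    rcases subsingleton_or_nontrivial Y with hY | hY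
    · -- Every operator is zero, hence attains its norm at `x₁`.
      refine Filter.univ_mem' fun T => ⟨x₁, hx₁, ?_⟩
      rw [Subsingleton.elim (T : X →L[𝕜] StrongDual 𝕜 Y) 0]
      simp
    · filter_upwards [exists_absExposesAt_flip_apply_mem_residual hRNP hdisc I hIclosed hIrank hNA]
        with T ⟨y₀, hy₀, x, hx, hxy⟩
      refine ⟨x, hx, le_antisymm (norm_apply_le_opNorm _ hx.le) ?_⟩
      rw [hy₀.norm_apply, ContinuousLinearMap.opNorm_flip] at hxy
      rw [← hxy]
      exact norm_apply_le_opNorm ((T : X →L[𝕜] StrongDual 𝕜 Y) x) hy₀.1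
  · rcases subsingleton_or_nontrivial X with hX | hX
    · refine ⟨fun T => subset_closure (normFrechetDifferentiableAt_of_subsingleton _),
        fun _ T => subset_closure ⟨0, by simp, fun u _ _ => ⟨fun _ => 1, by simp, ?_⟩⟩⟩
      exact tendsto_const_nhds.congr fun n => Subsingleton.elim _ _
    rcases subsingleton_or_nontrivial Y with hY | hY
    · exact ⟨fun T => subset_closure (normFrechetDifferentiableAt_of_subsingleton _),
        fun h => absurd h (not_nontrivial Y)⟩
    have hd := dense_exists_absExposesAt_of_dense_SE hRNP hdisc I hIclosed hIrank hSE
    refine ⟨hd.mono ?_, fun _ => hd.mono ?_⟩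
    · rintro T ⟨_, _, hy₀, hx₀⟩
      exact hy₀.normFrechetDifferentiableAt hx₀
    · rintro T ⟨_, _, hy₀, hx₀⟩
      exact (hy₀.of_flip hx₀).mem_ASE
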